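/- Let $H,\Sigma\in\mathbb{R}^{n\times n}$ with $H$ symmetric positive definite. Let $\mathcal{G}$ be the set of admissible preconditioners: either the set of all symmetric positive definite $n\times n$ matrices, or, if singular noise covariances are to be allowed, the set of all symmetric positive semidefinite $n\times n$ matrices; assume that the noise covariance satisfies $\Sigma\in\mathcal{G}$ and $\Sigma\neq 0$. Let $f(\theta)=\tfrac12\theta^{\top}H\theta$. For each $G\in\mathcal{G}$ with Frobenius norm $\|G\|_F=1$, let $(\theta^{G}_t)_{t\ge 0}$ be a continuous solution, started at $\theta^G_0=0$, of the preconditioned Langevin (Ornstein–Uhlenbeck) equation $$d\theta_t=-GH\theta_t\,dt+G\Sigma^{1/2}\,dn_t,$$ where $n_t$ is a standard $n$-dimensional Brownian motion (the probability space and the Brownian motion may depend on $G$). Then for every $G\in\mathcal{G}$ with $\|G\|_F=1$ the random variable $f(\theta^G_t)$ is integrable for every $t\ge 0$, the asymptotic expected loss exists, and $$\lim_{t\to\infty}\mathbb{E}\big[f(\theta^G_t)\big]=\tfrac14\operatorname{Tr}(\Sigma G).$$ Moreover, among all $G\in\mathcal{G}$ with $\|G\|_F=1$, the asymptotic expected loss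 has exactly one maximizer, namely $$G^*=\operatorname*{arg\,max}_{G\in\mathcal{G},\ \|G\|_F=1}\ \lim_{t\to\infty}\mathbb{E}\big[f(\theta^G_t)\big]=\frac{\Sigma}{\|\Sigma\|_F}.$$ -/

import Mathlib

open MeasureTheory ProbabilityTheory Filter Topology
open scoped NNReal MatrixOrder

namespace LangevinLoss

/-- A standard `n`-dimensional Brownian motion: the coordinates are independent real Brownian
motions (with almost surely continuous paths). -/
structure IsStandardBrownian {n : ℕ} {Ω : Type*} [MeasurableSpace Ω]
    (W : ℝ≥0 → Ω → Fin n → ℝ) (P : Measure Ω) : Prop where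
  isBrownian : ∀ i, IsBrownianReal (fun t ω => W t ω i) P
  indep : iIndepFun (fun (i : Fin n) (ω : Ω) (t : ℝ≥0) => W t ω i) P

/-- The process `θ`, started at the stationary point `0`, solves the preconditioned Langevin
equation `dθ_t = - G H θ_t dt + G S^{1/2} dW_t` of the quadratic objective with Hessian `H`,
with preconditioner `G` and noise covariance `S`. As the noise coefficient is constant, the
stochastic integral `∫₀ᵗ G S^{1/2} dW_s` is `G S^{1/2} W_t`, and the equation is required
pathwise in its integral form. `CFC.sqrt S` is the positive semidefinite square root of `S`. -/
structure IsPreconditionedLangevin {n : ℕ} {Ω : Type*} [MeasurableSpace Ω]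
    (G H S : Matrix (Fin n) (Fin n) ℝ) (W θ : ℝ≥0 → Ω → Fin n → ℝ) (P : Measure Ω) : Prop where
  continuous_path : ∀ᵐ ω ∂P, Continuous (fun t => θ t ω)
  equation : ∀ᵐ ω ∂P, ∀ t : ℝ≥0,
    θ t ω = -(∫ s in (0 : ℝ)..(t : ℝ), (G * H).mulVec (θ s.toNNReal ω))
      + (G * CFC.sqrt S).mulVec (W t ω)

/-- The quadratic objective `f x = (1/2) xᵀ H x`. -/
noncomputable def quadLoss {n : ℕ} (H : Matrix (Fin n) (Fin n) ℝ) (x : Fin n → ℝ) : ℝ :=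
  (1 / 2 : ℝ) * dotProduct x (H.mulVec x)

/-- The expected loss `𝔼[f(θ_t)]` at time `t`. -/
noncomputable def expectedLoss {n : ℕ} {Ω : Type*} [MeasurableSpace Ω]
    (H : Matrix (Fin n) (Fin n) ℝ) (θ : ℝ≥0 → Ω → Fin n → ℝ) (P : Measure Ω) (t : ℝ≥0) : ℝ :=
  ∫ ω, quadLoss H (θ t ω) ∂P

/-- The asymptotic expected loss `lim_{t → ∞} 𝔼[f(θ_t)]`. -/
noncomputable def asymptoticLoss {n : ℕ} {Ω : Type*} [MeasurableSpace Ω]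
    (H : Matrix (Fin n) (Fin n) ℝ) (θ : ℝ≥0 → Ω → Fin n → ℝ) (P : Measure Ω) : ℝ :=
  limUnder atTop (expectedLoss H θ P)

section Frobenius

attribute [local instance] Matrix.frobeniusNormedAddCommGroup

/-- The Frobenius norm. -/
noncomputable def frobeniusNorm {n : ℕ} (A : Matrix (Fin n) (Fin n) ℝ) : ℝ := ‖A‖

end Frobenius

/-- The set of maximizers of `L` on `s`. -/
def argmaxSet {α : Type*} (s : Set α) (L : α → ℝ) : Set α := {a | a ∈ s ∧ IsMaxOn L s a}

end LangevinLoss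

/-! Write `H = RᵀR` with `R G Rᵀ = diagonal l` and `l ≥ 0`. Then `R G H = diagonal l * R`, so the
coordinates of `x = R θ` satisfy scalar equations `dx_i = -l_i x_i dt + c_i · dW`, and the loss is
`½ ∑ x_i²`. With `M = R⁻ᵀ S R⁻¹` the noise variance is `c_i · c_i = l_i² M_ii`, hence `𝔼 x_i² = l_i
M_ii (1 - exp(-2 l_i t)) / 2`. Letting `t → ∞` and summing gives `¼ tr(diagonal l * M) = ¼ tr(S G)`;
modes with `l_i = 0` carry no noise and contribute `0`. The cross-covariances of the `x_i` are never
needed.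

No Itô calculus enters: variation of constants writes each `x_i` through an ordinary integral of the
driving path, and Fubini with the covariance `a * min s r` gives the second moment
(`second_moment_sub_integral_exp`).

On the unit sphere, with `k = 1/‖S‖`, `‖G - k S‖² = 2 - 2 k tr(S G)`, so maximizing the trace means
minimizing the distance to `k S`. -/

namespace LangevinLoss

/-! ### Pathwise preliminaries -/

/-- A process with almost surely continuous paths is indistinguishable from a process with
measurable marginals all of whose paths are continuous. -/
lemma exists_measurable_continuous_indistinguishable {Ω : Type*} [MeasurableSpace Ω]
    {P : Measure Ω} {w : ℝ≥0 → Ω → ℝ} (hm : ∀ t, AEMeasurable (w t) P)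
    (hc : ∀ᵐ ω ∂P, Continuous (fun t => w t ω)) :
    ∃ v : ℝ≥0 → Ω → ℝ, (∀ t, Measurable (v t)) ∧ (∀ ω, Continuous (fun t => v t ω)) ∧
      ∀ᵐ ω ∂P, ∀ t, w t ω = v t ω := by
  classical
  -- Only countably many null sets can be discarded, so measurability is arranged on a dense set of
  -- times; path continuity carries it to every time.
  obtain ⟨d, hdc, hdd⟩ := TopologicalSpace.exists_countable_dense ℝ≥0
  have hq : ∀ᵐ ω ∂P, ∀ q ∈ d, w q ω = (hm q).mk (w q) ω :=
    (ae_ball_iff hdc).2 fun q _ => (hm q).ae_eq_mk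
  have hall : ∀ᵐ ω ∂P, Continuous (fun t => w t ω) ∧ ∀ q ∈ d, w q ω = (hm q).mk (w q) ω :=
    hc.and hq
  set N : Set Ω := toMeasurable P {ω | ¬ (Continuous (fun t => w t ω) ∧
    ∀ q ∈ d, w q ω = (hm q).mk (w q) ω)} with hN
  have hNm : MeasurableSet N := measurableSet_toMeasurable _ _
  have hN0 : P N = 0 := by rw [hN, measure_toMeasurable]; exact hall
  have hNc : ∀ ω ∉ N, Continuous (fun t => w t ω) ∧ ∀ q ∈ d, w q ω = (hm q).mk (w q) ω := by
    intro ω hω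
    by_contra h
    exact hω (subset_toMeasurable _ _ h)
  have hdm : ∀ q ∈ d, Measurable (fun ω => if ω ∈ N then 0 else w q ω) := by
    intro q hqd
    have : (fun ω => if ω ∈ N then 0 else w q ω)
        = fun ω => if ω ∈ N then 0 else (hm q).mk (w q) ω := by
      funext ω
      by_cases h : ω ∈ N
      · simp [h]
      · simp [h, (hNc ω h).2 q hqd]
    rw [this]
    exact Measurable.ite hNm measurable_const (hm q).measurable_mk
  have hcont : ∀ ω, Continuous (fun t => if ω ∈ N then 0 else w t ω) := by
    intro ω
    by_cases h : ω ∈ N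
    · simp [h, continuous_const]
    · simpa [h] using (hNc ω h).1
  refine ⟨fun t ω => if ω ∈ N then 0 else w t ω, fun t => ?_, hcont, ?_⟩
  · obtain ⟨u, hu, hut⟩ := mem_closure_iff_seq_limit.1 (hdd t)
    refine measurable_of_tendsto_metrizable (fun k => hdm (u k) (hu k)) ?_
    rw [tendsto_pi_nhds]
    exact fun ω => ((hcont ω).tendsto t).comp hut
  · filter_upwards [measure_eq_zero_iff_ae_notMem.1 hN0] with ω hω t
    simp [hω]

/-- The variation of constants formula for `z = - l ∫ z + w`. -/
lemma eq_sub_integral_exp_of_eq_neg_integral_add {l : ℝ} {z w : ℝ → ℝ} (hz : Continuous z)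
    (hw : Continuous w) (h : ∀ t, 0 ≤ t → z t = -(l * ∫ s in (0 : ℝ)..t, z s) + w t)
    {t : ℝ} (ht : 0 ≤ t) :
    z t = w t - l * ∫ s in (0 : ℝ)..t, Real.exp (-(l * (t - s))) * w s := by
  set Y : ℝ → ℝ := fun t => ∫ s in (0 : ℝ)..t, z s with hY
  have hY' : ∀ x, HasDerivAt Y (z x) x := fun x => hz.integral_hasStrictDerivAt 0 x |>.hasDerivAt
  -- Integrating factor: with `Y = ∫ z` the equation reads `Y' = -l Y + w`.
  have hE : ∀ x ∈ Set.uIcc 0 t,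
      HasDerivAt (fun x => Real.exp (l * x) * Y x) (Real.exp (l * x) * w x) x := by
    intro x hx
    rw [Set.uIcc_of_le ht] at hx
    have h1 : HasDerivAt (fun x => Real.exp (l * x)) (Real.exp (l * x) * l) x := by
      simpa using ((hasDerivAt_id x).const_mul l).exp
    refine (h1.mul (hY' x)).congr_deriv ?_
    rw [h x hx.1]
    ring
  have hI := intervalIntegral.integral_eq_sub_of_hasDerivAt hE
    (Continuous.intervalIntegrable (by fun_prop) _ _)
  have hY0 : Y 0 = 0 := by simp [hY]
  rw [hY0, mul_zero, sub_zero] at hI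
  have h2 : ∫ s in (0 : ℝ)..t, Real.exp (-(l * (t - s))) * w s = Y t := by
    have : ∀ s, Real.exp (-(l * (t - s))) * w s
        = Real.exp (-(l * t)) * (Real.exp (l * s) * w s) := by
      intro s
      rw [← mul_assoc, ← Real.exp_add]
      ring_nf
    simp_rw [this]
    rw [intervalIntegral.integral_const_mul, hI, ← mul_assoc, ← Real.exp_add]
    simp
  rw [h2, h t ht]
  ring

lemma sq_intervalIntegral_le {f : ℝ → ℝ} (hf : Continuous f) {t : ℝ} (ht : 0 ≤ t) :
    (∫ s in (0 : ℝ)..t, f s) ^ 2 ≤ t * ∫ s in (0 : ℝ)..t, f s ^ 2 := by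
  rcases ht.eq_or_lt with rfl | ht
  · simp
  set a := ∫ s in (0 : ℝ)..t, f s with ha
  -- Cauchy–Schwarz as nonnegativity of a variance, scaled by `t` so that no mean has to be divided
  -- out.
  have h0 : 0 ≤ ∫ s in (0 : ℝ)..t, (t * f s - a) ^ 2 :=
    intervalIntegral.integral_nonneg ht.le fun _ _ => sq_nonneg _
  have h1 : ∫ s in (0 : ℝ)..t, (t * f s - a) ^ 2
      = t ^ 2 * (∫ s in (0 : ℝ)..t, f s ^ 2) - 2 * a * t * a + a ^ 2 * t := by
    have : ∀ s, (t * f s - a) ^ 2 = t ^ 2 * f s ^ 2 - 2 * a * t * f s + a ^ 2 := fun s => by ring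
    simp_rw [this]
    rw [intervalIntegral.integral_add, intervalIntegral.integral_sub,
      intervalIntegral.integral_const_mul, intervalIntegral.integral_const_mul,
      intervalIntegral.integral_const, ← ha]
    · simp; ring
    all_goals exact Continuous.intervalIntegrable (by fun_prop) _ _
  rw [h1] at h0
  have : 0 ≤ t * (t * (∫ s in (0 : ℝ)..t, f s ^ 2) - a ^ 2) := by linarith
  linarith [nonneg_of_mul_nonneg_right this ht]

/-! ### Exchanging expectation and time integral -/

section Fubini

variable {Ω : Type*} [MeasurableSpace Ω] {P : Measure Ω} [IsProbabilityMeasure P]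
  {v : ℝ → Ω → ℝ} {a t : ℝ}

lemma integrable_prod_sq (hv : Measurable (Function.uncurry v))
    (hint : ∀ s, Integrable (fun ω => v s ω ^ 2) P)
    (hvar : ∀ s ∈ Set.Ioc 0 t, ∫ ω, v s ω ^ 2 ∂P ≤ a) :
    Integrable (fun p : ℝ × Ω => v p.1 p.2 ^ 2) ((volume.restrict (Set.Ioc 0 t)).prod P) := by
  have hm : Measurable (fun p : ℝ × Ω => v p.1 p.2 ^ 2) := hv.pow_const 2
  rw [integrable_prod_iff hm.aestronglyMeasurable]
  refine ⟨Eventually.of_forall hint, ?_⟩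
  refine Integrable.mono' (integrable_const a)
    (hm.norm.stronglyMeasurable.integral_prod_right (ν := P)).aestronglyMeasurable ?_
  filter_upwards [ae_restrict_mem measurableSet_Ioc] with s hs
  simp only [norm_pow, Real.norm_eq_abs, sq_abs]
  rw [abs_of_nonneg (integral_nonneg fun _ => sq_nonneg _)]
  exact hvar s hs

/-- Dominated by `C * (X² + v²)`, where `C` bounds `g` on `[0, t]`. -/
lemma integrable_prod_mul (hv : Measurable (Function.uncurry v))
    (hint : ∀ s, Integrable (fun ω => v s ω ^ 2) P)
    (hvar : ∀ s ∈ Set.Ioc 0 t, ∫ ω, v s ω ^ 2 ∂P ≤ a) {g : ℝ → ℝ} (hg : Continuous g)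
    {X : Ω → ℝ} (hX : MemLp X 2 P) :
    Integrable (fun p : ℝ × Ω => g p.1 * (X p.2 * v p.1 p.2))
      ((volume.restrict (Set.Ioc 0 t)).prod P) := by
  obtain ⟨C, hC⟩ := isCompact_Icc.exists_bound_of_continuousOn (s := Set.Icc 0 t)
    hg.continuousOn
  have h1 : Integrable (fun p : ℝ × Ω => X p.2 ^ 2 + v p.1 p.2 ^ 2)
      ((volume.restrict (Set.Ioc 0 t)).prod P) :=
    (hX.integrable_sq.comp_snd _).add (integrable_prod_sq hv hint hvar)
  refine (h1.const_mul C).mono' ?_ ?_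
  · exact (hg.measurable.comp measurable_fst).aestronglyMeasurable.mul
      (hX.aestronglyMeasurable.comp_snd.mul hv.aestronglyMeasurable)
  · have : ∀ᵐ p ∂((volume.restrict (Set.Ioc 0 t)).prod P), p.1 ∈ Set.Ioc 0 t :=
      Measure.quasiMeasurePreserving_fst.ae (ae_restrict_mem measurableSet_Ioc)
    filter_upwards [this] with p hp
    rw [norm_mul, norm_mul]
    simp only [Real.norm_eq_abs] at hC ⊢
    have h2 : |X p.2| * |v p.1 p.2| ≤ X p.2 ^ 2 + v p.1 p.2 ^ 2 := by
      rw [← sq_abs (X p.2), ← sq_abs (v p.1 p.2)]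
      nlinarith [sq_nonneg (|X p.2| - |v p.1 p.2|), sq_nonneg (|X p.2|), sq_nonneg (|v p.1 p.2|)]
    exact mul_le_mul (hC _ ⟨hp.1.le, hp.2⟩) h2 (by positivity)
      ((abs_nonneg _).trans (hC _ ⟨hp.1.le, hp.2⟩))

lemma integral_mul_intervalIntegral (hv : Measurable (Function.uncurry v))
    (hint : ∀ s, Integrable (fun ω => v s ω ^ 2) P)
    (hvar : ∀ s ∈ Set.Ioc 0 t, ∫ ω, v s ω ^ 2 ∂P ≤ a) {g : ℝ → ℝ} (hg : Continuous g)
    {X : Ω → ℝ} (hX : MemLp X 2 P) (ht : 0 ≤ t) :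
    ∫ ω, X ω * (∫ s in (0 : ℝ)..t, g s * v s ω) ∂P
      = ∫ s in (0 : ℝ)..t, g s * ∫ ω, X ω * v s ω ∂P := by
  have h := integral_integral_swap (f := fun s ω => g s * (X ω * v s ω))
    (integrable_prod_mul hv hint hvar hg hX)
  rw [intervalIntegral.integral_of_le ht]
  simp_rw [intervalIntegral.integral_of_le ht, ← integral_const_mul]
  rw [h]
  refine integral_congr_ae (Eventually.of_forall fun ω => ?_)
  refine integral_congr_ae (Eventually.of_forall fun s => ?_)
  ring

/-- Cauchy–Schwarz in time bounds the square by `t C² ∫ v²`, which is integrable over `Ω` by Fubini.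
-/
lemma memLp_intervalIntegral (hv : Measurable (Function.uncurry v))
    (hc : ∀ ω, Continuous (fun s => v s ω))
    (hint : ∀ s, Integrable (fun ω => v s ω ^ 2) P)
    (hvar : ∀ s ∈ Set.Ioc 0 t, ∫ ω, v s ω ^ 2 ∂P ≤ a) {g : ℝ → ℝ} (hg : Continuous g)
    (ht : 0 ≤ t) :
    MemLp (fun ω => ∫ s in (0 : ℝ)..t, g s * v s ω) 2 P := by
  obtain ⟨C, hC⟩ := isCompact_Icc.exists_bound_of_continuousOn (s := Set.Icc 0 t)
    hg.continuousOn
  have hm : StronglyMeasurable (fun ω => ∫ s in (0 : ℝ)..t, g s * v s ω) := by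
    simp_rw [intervalIntegral.integral_of_le ht]
    have : Measurable (fun p : ℝ × Ω => g p.1 * v p.1 p.2) :=
      (hg.measurable.comp measurable_fst).mul hv
    exact this.stronglyMeasurable.integral_prod_left
      (μ := volume.restrict (Set.Ioc 0 t))
  rw [memLp_two_iff_integrable_sq hm.aestronglyMeasurable]
  have h1 := (integrable_prod_sq hv hint hvar).integral_prod_right
  refine (h1.const_mul (t * C ^ 2)).mono' (hm.pow 2).aestronglyMeasurable
    (Eventually.of_forall fun ω => ?_)
  rw [norm_pow, Real.norm_eq_abs, sq_abs]
  refine (sq_intervalIntegral_le (hg.mul (hc ω)) ht).trans ?_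
  rw [mul_assoc]
  refine mul_le_mul_of_nonneg_left ?_ ht
  dsimp only
  rw [← intervalIntegral.integral_of_le ht, ← intervalIntegral.integral_const_mul]
  have hcω := hc ω
  refine intervalIntegral.integral_mono_on ht
    (Continuous.intervalIntegrable (by fun_prop) _ _)
    (Continuous.intervalIntegrable (by fun_prop) _ _) fun s hs => ?_
  simp only [Pi.mul_apply, mul_pow]
  refine mul_le_mul_of_nonneg_right ?_ (sq_nonneg _)
  rw [← sq_abs]
  exact pow_le_pow_left₀ (abs_nonneg _) (hC s hs) 2

end Fubini

/-! ### Second moment of the scalar Ornstein–Uhlenbeck process -/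

lemma hasDerivAt_exp_neg_mul_sub (l t r : ℝ) :
    HasDerivAt (fun r => Real.exp (-(l * (t - r)))) (Real.exp (-(l * (t - r))) * l) r := by
  have h0 : HasDerivAt (fun r => -(l * (t - r))) l r := by
    refine (((hasDerivAt_id r).const_sub t).const_mul l).neg.congr_deriv ?_
    ring
  exact h0.exp

/-- Up to the factor `a`, this is `𝔼[v_s I]` for `I = ∫ exp(-l(t-r)) v_r dr`. The integral is split
at the kink `r = s` of the minimum. -/
lemma integral_exp_mul_min {l s t : ℝ} (hl : l ≠ 0) (hs : 0 ≤ s) (hst : s ≤ t) :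
    ∫ r in (0 : ℝ)..t, Real.exp (-(l * (t - r))) * min s r
      = s / l + (Real.exp (-(l * t)) - Real.exp (-(l * (t - s)))) / l ^ 2 := by
  have hcont : Continuous fun r => Real.exp (-(l * (t - r))) * min s r := by fun_prop
  have he := hasDerivAt_exp_neg_mul_sub l t
  rw [← intervalIntegral.integral_add_adjacent_intervals (hcont.intervalIntegrable 0 s)
    (hcont.intervalIntegrable s t)]
  have h1 : ∫ r in (0 : ℝ)..s, Real.exp (-(l * (t - r))) * min s r
      = ∫ r in (0 : ℝ)..s, Real.exp (-(l * (t - r))) * r := by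
    refine intervalIntegral.integral_congr fun r hr => ?_
    rw [Set.uIcc_of_le hs] at hr
    simp only [min_eq_right hr.2]
  have h2 : ∫ r in s..t, Real.exp (-(l * (t - r))) * min s r
      = ∫ r in s..t, Real.exp (-(l * (t - r))) * s := by
    refine intervalIntegral.integral_congr fun r hr => ?_
    rw [Set.uIcc_of_le hst] at hr
    simp only [min_eq_left hr.1]
  have d1 : ∀ r ∈ Set.uIcc 0 s, HasDerivAt
      (fun r => Real.exp (-(l * (t - r))) * (r / l - 1 / l ^ 2))
      (Real.exp (-(l * (t - r))) * r) r := fun r _ => by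
    refine ((he r).mul (((hasDerivAt_id r).div_const l).sub_const (1 / l ^ 2))).congr_deriv ?_
    simp only [id]
    field_simp
    ring
  have d2 : ∀ r ∈ Set.uIcc s t, HasDerivAt
      (fun r => Real.exp (-(l * (t - r))) * (s / l))
      (Real.exp (-(l * (t - r))) * s) r := fun r _ => by
    refine ((he r).mul_const (s / l)).congr_deriv ?_
    field_simp
  rw [h1, h2, intervalIntegral.integral_eq_sub_of_hasDerivAt d1
    (Continuous.intervalIntegrable (by fun_prop) _ _),
    intervalIntegral.integral_eq_sub_of_hasDerivAt d2
    (Continuous.intervalIntegrable (by fun_prop) _ _)]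
  simp only [sub_self, mul_zero, neg_zero, Real.exp_zero, sub_zero]
  field_simp
  ring

/-- Integrating the value of `integral_exp_mul_min` against the same kernel gives `𝔼[I²] / a`. -/
lemma integral_exp_mul_covariance {l t : ℝ} (hl : l ≠ 0) :
    ∫ s in (0 : ℝ)..t, Real.exp (-(l * (t - s))) *
        (s / l + (Real.exp (-(l * t)) - Real.exp (-(l * (t - s)))) / l ^ 2)
      = t / l ^ 2 - 3 / (2 * l ^ 3) + 2 * Real.exp (-(l * t)) / l ^ 3
        - Real.exp (-(l * t)) ^ 2 / (2 * l ^ 3) := by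
  have he := hasDerivAt_exp_neg_mul_sub l t
  have d : ∀ r ∈ Set.uIcc 0 t, HasDerivAt
      (fun r => Real.exp (-(l * (t - r))) * (r / l ^ 2 - 1 / l ^ 3 + Real.exp (-(l * t)) / l ^ 3)
        - Real.exp (-(l * (t - r))) ^ 2 / (2 * l ^ 3))
      (Real.exp (-(l * (t - r))) *
        (r / l + (Real.exp (-(l * t)) - Real.exp (-(l * (t - r)))) / l ^ 2)) r := fun r _ => by
    refine (((he r).mul ((((hasDerivAt_id r).div_const (l ^ 2)).sub_const (1 / l ^ 3)).add_const
      (Real.exp (-(l * t)) / l ^ 3))).sub (((he r).pow 2).div_const (2 * l ^ 3))).congr_deriv ?_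
    simp only [id]
    field_simp
    ring
  rw [intervalIntegral.integral_eq_sub_of_hasDerivAt d
    (Continuous.intervalIntegrable (by fun_prop) _ _)]
  simp only [sub_self, mul_zero, neg_zero, Real.exp_zero, sub_zero]
  field_simp
  ring

/-- The second moment of the Ornstein–Uhlenbeck process, in its variation of constants form, driven
by a process with the covariance `a * min s r`. -/
lemma second_moment_sub_integral_exp {Ω : Type*} [MeasurableSpace Ω] {P : Measure Ω}
    [IsProbabilityMeasure P] {v : ℝ → Ω → ℝ} {a l t : ℝ} (hl : l ≠ 0) (ht : 0 ≤ t)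
    (hv : Measurable (Function.uncurry v)) (hc : ∀ ω, Continuous (fun s => v s ω))
    (hL2 : ∀ s, MemLp (v s) 2 P)
    (hcov : ∀ s r, 0 ≤ s → 0 ≤ r → ∫ ω, v s ω * v r ω ∂P = a * min s r) :
    Integrable (fun ω =>
      (v t ω - l * ∫ s in (0 : ℝ)..t, Real.exp (-(l * (t - s))) * v s ω) ^ 2) P ∧
    ∫ ω, (v t ω - l * ∫ s in (0 : ℝ)..t, Real.exp (-(l * (t - s))) * v s ω) ^ 2 ∂P
      = a * ((1 - Real.exp (-(l * t)) ^ 2) / (2 * l)) := by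
  have hint : ∀ s, Integrable (fun ω => v s ω ^ 2) P := fun s => (hL2 s).integrable_sq
  have ha : 0 ≤ a := by
    have h := hcov 1 1 zero_le_one zero_le_one
    rw [min_self, mul_one] at h
    exact h ▸ integral_nonneg fun _ => mul_self_nonneg _
  have hvar : ∀ s ∈ Set.Ioc 0 t, ∫ ω, v s ω ^ 2 ∂P ≤ a * t := by
    intro s hs
    simp_rw [sq, hcov s s hs.1.le hs.1.le, min_self]
    exact mul_le_mul_of_nonneg_left hs.2 ha
  have hg : Continuous fun s => Real.exp (-(l * (t - s))) := by fun_prop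
  set I : Ω → ℝ := fun ω => ∫ s in (0 : ℝ)..t, Real.exp (-(l * (t - s))) * v s ω with hI
  have hIL : MemLp I 2 P := memLp_intervalIntegral hv hc hint hvar hg ht
  have hvI : ∀ s ∈ Set.Icc 0 t, ∫ ω, v s ω * I ω ∂P
      = a * (s / l + (Real.exp (-(l * t)) - Real.exp (-(l * (t - s)))) / l ^ 2) := by
    intro s hs
    rw [hI, integral_mul_intervalIntegral hv hint hvar hg (hL2 s) ht,
      ← integral_exp_mul_min hl hs.1 hs.2, ← intervalIntegral.integral_const_mul]
    refine intervalIntegral.integral_congr fun r hr => ?_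
    rw [Set.uIcc_of_le ht] at hr
    simp only [hcov s r hs.1 hr.1]
    ring
  -- The exchange is applied with `X = I` itself, leaving the mixed moments `hvI` under the
  -- integral.
  have hII : ∫ ω, I ω * I ω ∂P = a * (t / l ^ 2 - 3 / (2 * l ^ 3)
      + 2 * Real.exp (-(l * t)) / l ^ 3 - Real.exp (-(l * t)) ^ 2 / (2 * l ^ 3)) := by
    rw [integral_mul_intervalIntegral hv hint hvar hg hIL ht, ← integral_exp_mul_covariance hl,
      ← intervalIntegral.integral_const_mul]
    refine intervalIntegral.integral_congr fun r hr => ?_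
    rw [Set.uIcc_of_le ht] at hr
    simp only [mul_comm (I _), hvI r hr]
    ring
  refine ⟨((hL2 t).sub (hIL.const_mul l)).integrable_sq, ?_⟩
  have hexp : ∀ ω, (v t ω - l * I ω) ^ 2
      = v t ω * v t ω - 2 * l * (v t ω * I ω) + l ^ 2 * (I ω * I ω) := fun ω => by ring
  have i1 : Integrable (fun ω => v t ω * v t ω) P := (hL2 t).integrable_mul (hL2 t)
  have i2 : Integrable (fun ω => 2 * l * (v t ω * I ω)) P :=
    ((hL2 t).integrable_mul hIL).const_mul _
  have i3 : Integrable (fun ω => l ^ 2 * (I ω * I ω)) P := (hIL.integrable_mul hIL).const_mul _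
  refine (integral_congr_ae (Eventually.of_forall hexp)).trans ?_
  have i12 : Integrable (fun ω => v t ω * v t ω - 2 * l * (v t ω * I ω)) P := i1.sub i2
  rw [integral_add i12 i3, integral_sub i1 i2, integral_const_mul, integral_const_mul,
    hcov t t ht ht, hvI t ⟨ht, le_rfl⟩, hII]
  simp only [min_self, sub_self, mul_zero, neg_zero, Real.exp_zero]
  field_simp
  ring

/-- The second moment of the Ornstein–Uhlenbeck process `dz = - l z dt + dw` started at `0`. -/
theorem second_moment_ornsteinUhlenbeck {Ω : Type*} [MeasurableSpace Ω] {P : Measure Ω}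
    [IsProbabilityMeasure P] {w z : ℝ≥0 → Ω → ℝ} {a l : ℝ} (hl : l ≠ 0)
    (hL2 : ∀ s, MemLp (w s) 2 P) (hw : ∀ᵐ ω ∂P, Continuous (fun t => w t ω))
    (hcov : ∀ s r, ∫ ω, w s ω * w r ω ∂P = a * min s r)
    (hz : ∀ᵐ ω ∂P, Continuous (fun t => z t ω))
    (h : ∀ᵐ ω ∂P, ∀ t : ℝ≥0,
      z t ω = -(l * ∫ s in (0 : ℝ)..(t : ℝ), z s.toNNReal ω) + w t ω) (t : ℝ≥0) :
    Integrable (fun ω => z t ω ^ 2) P ∧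
    ∫ ω, z t ω ^ 2 ∂P = a * ((1 - Real.exp (-(l * t)) ^ 2) / (2 * l)) := by
  obtain ⟨v, hvm, hvc, hvw⟩ := exists_measurable_continuous_indistinguishable
    (fun t => (hL2 t).aestronglyMeasurable.aemeasurable) hw
  have hc : ∀ ω, Continuous (fun s : ℝ => v s.toNNReal ω) := fun ω =>
    (hvc ω).comp continuous_real_toNNReal
  have hv : Measurable (Function.uncurry fun (s : ℝ) ω => v s.toNNReal ω) :=
    measurable_uncurry_of_continuous_of_measurable hc fun s => hvm s.toNNReal
  have hwv : ∀ s, w s =ᵐ[P] v s := fun s => hvw.mono fun ω hω => hω s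
  have key := second_moment_sub_integral_exp (P := P) (v := fun (s : ℝ) ω => v s.toNNReal ω)
    (a := a) hl t.2 hv hc (fun s => (memLp_congr_ae (hwv _)).1 (hL2 _)) (by
      intro s r hs hr
      have := hcov s.toNNReal r.toNNReal
      rw [NNReal.coe_min, Real.coe_toNNReal _ hs, Real.coe_toNNReal _ hr] at this
      rw [← this]
      refine integral_congr_ae ?_
      filter_upwards [hvw] with ω hω
      rw [hω, hω])
  have hzv : ∀ᵐ ω ∂P, (v (t : ℝ).toNNReal ω
      - l * ∫ s in (0 : ℝ)..t, Real.exp (-(l * (t - s))) * v s.toNNReal ω) ^ 2 = z t ω ^ 2 := by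
    filter_upwards [hvw, hz, h] with ω h1 h2 h3
    have h4 := eq_sub_integral_exp_of_eq_neg_integral_add (l := l)
      (z := fun s => z s.toNNReal ω) (w := fun s => v s.toNNReal ω)
      (h2.comp continuous_real_toNNReal) (hc ω) (fun s hs => by
        have := h3 s.toNNReal
        rwa [h1, Real.coe_toNNReal _ hs] at this) t.2
    simp only [Real.toNNReal_coe, NNReal.val_eq_coe] at h4 ⊢
    rw [h4]
  exact ⟨key.1.congr hzv, (integral_congr_ae hzv).symm.trans key.2⟩

/-! ### Simultaneous diagonalization -/

open Matrix in
/-- A positive definite and a positive semidefinite form are simultaneously diagonalizable. -/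
lemma exists_simultaneous_diagonalization {n : ℕ} {H G : Matrix (Fin n) (Fin n) ℝ}
    (hH : H.PosDef) (hG : G.PosSemidef) :
    ∃ (R : Matrix (Fin n) (Fin n) ℝ) (l : Fin n → ℝ), IsUnit R.det ∧ Rᵀ * R = H ∧
      R * G * Rᵀ = diagonal l ∧ ∀ i, 0 ≤ l i := by
  set L := CFC.sqrt H with hL
  have hLL : L * L = H := CFC.sqrt_mul_sqrt_self H hH.posSemidef.nonneg
  have hLp : L.PosSemidef := (CFC.sqrt_nonneg H).posSemidef
  have hLt : Lᵀ = L := by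
    have := hLp.isHermitian.eq
    rwa [conjTranspose_eq_transpose_of_trivial] at this
  have hN : (L * G * Lᵀ).PosSemidef := by
    have := hG.mul_mul_conjTranspose_same L
    rwa [conjTranspose_eq_transpose_of_trivial] at this
  -- The congruence is `R = Uᵀ L`, where `U` diagonalizes `L G Lᵀ` orthogonally; orthogonality
  -- preserves `RᵀR = L² = H`.
  set U : Matrix (Fin n) (Fin n) ℝ := ↑hN.isHermitian.eigenvectorUnitary with hU
  have hUt : star U = Uᵀ := by
    rw [star_eq_conjTranspose, conjTranspose_eq_transpose_of_trivial]
  have hUU : U * Uᵀ = 1 := by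
    rw [← hUt]; exact Unitary.coe_mul_star_self _
  have hUN : Uᵀ * (L * G * Lᵀ) * U = diagonal hN.isHermitian.eigenvalues := by
    have := hN.isHermitian.conjStarAlgAut_star_eigenvectorUnitary
    rw [Unitary.conjStarAlgAut_star_apply] at this
    rw [← hUt]
    exact this
  have hR : (Uᵀ * L)ᵀ * (Uᵀ * L) = H := by
    rw [transpose_mul, transpose_transpose, hLt, Matrix.mul_assoc, ← Matrix.mul_assoc U, hUU,
      Matrix.one_mul, hLL]
  refine ⟨Uᵀ * L, hN.isHermitian.eigenvalues, ?_, hR, ?_, hN.eigenvalues_nonneg⟩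
  · have h : IsUnit ((Uᵀ * L)ᵀ * (Uᵀ * L)).det := by
      rw [hR]; exact (isUnit_iff_isUnit_det _).1 hH.isUnit
    rw [det_mul] at h
    exact isUnit_of_mul_isUnit_right h
  · rw [← hUN, transpose_mul, transpose_transpose]
    simp only [Matrix.mul_assoc]

/-! ### Frobenius norm and maximization of the trace -/

section Frobenius

attribute [local instance] Matrix.frobeniusNormedAddCommGroup

lemma frobeniusNorm_sq {n : ℕ} (A : Matrix (Fin n) (Fin n) ℝ) :
    frobeniusNorm A ^ 2 = ∑ i, ∑ j, A i j ^ 2 := by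
  rw [frobeniusNorm, Matrix.frobenius_norm_def, ← Real.sqrt_eq_rpow, Real.sq_sqrt]
  · simp
  · positivity

lemma frobeniusNorm_nonneg {n : ℕ} (A : Matrix (Fin n) (Fin n) ℝ) : 0 ≤ frobeniusNorm A :=
  norm_nonneg A

lemma frobeniusNorm_eq_zero {n : ℕ} {A : Matrix (Fin n) (Fin n) ℝ} :
    frobeniusNorm A = 0 ↔ A = 0 :=
  norm_eq_zero

end Frobenius

lemma frobeniusNorm_smul {n : ℕ} {c : ℝ} (hc : 0 ≤ c) (A : Matrix (Fin n) (Fin n) ℝ) :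
    frobeniusNorm (c • A) = c * frobeniusNorm A := by
  rw [← sq_eq_sq₀ (frobeniusNorm_nonneg _) (mul_nonneg hc (frobeniusNorm_nonneg _)), mul_pow,
    frobeniusNorm_sq, frobeniusNorm_sq]
  simp [mul_pow, Finset.mul_sum]

lemma frobeniusNorm_sub_sq {n : ℕ} {A B : Matrix (Fin n) (Fin n) ℝ} (hA : A.IsSymm) :
    frobeniusNorm (B - A) ^ 2
      = frobeniusNorm B ^ 2 - 2 * (A * B).trace + frobeniusNorm A ^ 2 := by
  simp only [frobeniusNorm_sq, Matrix.trace, Matrix.diag_apply, Matrix.mul_apply,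
    Matrix.sub_apply]
  rw [Finset.sum_comm (f := fun i j => A i j * B j i)]
  simp only [Finset.mul_sum, ← Finset.sum_sub_distrib, ← Finset.sum_add_distrib]
  refine Finset.sum_congr rfl fun i _ => Finset.sum_congr rfl fun j _ => ?_
  rw [hA.apply i j]
  ring

/-- The normalization of `S` is the only maximizer of `G ↦ tr (S G)` on the unit sphere of the
Frobenius norm. -/
lemma argmaxSet_trace_mul {n : ℕ} {S : Matrix (Fin n) (Fin n) ℝ} (hS : S.IsSymm) (hS0 : S ≠ 0)
    {s : Set (Matrix (Fin n) (Fin n) ℝ)} (hs : ∀ G ∈ s, frobeniusNorm G = 1)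
    (hmem : (frobeniusNorm S)⁻¹ • S ∈ s) {L : Matrix (Fin n) (Fin n) ℝ → ℝ} {c : ℝ} (hc : 0 < c)
    (hL : ∀ G ∈ s, L G = c * (S * G).trace) :
    argmaxSet s L = {(frobeniusNorm S)⁻¹ • S} := by
  have hpos : 0 < frobeniusNorm S :=
    (frobeniusNorm_nonneg S).lt_of_ne' (mt frobeniusNorm_eq_zero.1 hS0)
  set k := (frobeniusNorm S)⁻¹ with hk
  have hkpos : 0 < k := inv_pos.2 hpos
  have hdist : ∀ G ∈ s, frobeniusNorm (G - k • S) ^ 2 = 2 - 2 * (k * (S * G).trace) := by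
    intro G hG
    rw [frobeniusNorm_sub_sq (hS.smul k), hs G hG, hs _ hmem]
    simp
    ring
  -- The distance identity at `G = k • S`, where the distance is zero.
  have hself : k * (S * (k • S)).trace = 1 := by
    have := hdist _ hmem
    rw [sub_self, frobeniusNorm_eq_zero.2 rfl] at this
    linarith
  ext G
  simp only [argmaxSet, Set.mem_ofPred_eq, Set.mem_singleton_iff]
  constructor
  · rintro ⟨hG, hmax⟩
    have h1 := hmax hmem
    simp only [Set.mem_ofPred_eq, hL G hG, hL _ hmem] at h1
    have h2 : (S * (k • S)).trace ≤ (S * G).trace := le_of_mul_le_mul_left h1 hc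
    have h3 := mul_le_mul_of_nonneg_left h2 hkpos.le
    have h4 := hdist G hG
    have h5 : frobeniusNorm (G - k • S) ^ 2 = 0 :=
      le_antisymm (by linarith) (sq_nonneg _)
    exact sub_eq_zero.1 (frobeniusNorm_eq_zero.1 (pow_eq_zero_iff two_ne_zero |>.1 h5))
  · rintro rfl
    refine ⟨hmem, fun G hG => ?_⟩
    simp only [Set.mem_ofPred_eq, hL G hG, hL _ hmem]
    refine mul_le_mul_of_nonneg_left ?_ hc.le
    refine le_of_mul_le_mul_left ?_ hkpos
    rw [hself]
    linarith [hdist G hG, sq_nonneg (frobeniusNorm (G - k • S))]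

/-! ### Moments of Brownian motion -/

section Brownian

variable {n : ℕ} {Ω : Type*} [MeasurableSpace Ω] {P : Measure Ω} {W : ℝ≥0 → Ω → Fin n → ℝ}

lemma IsStandardBrownian.memLp_two (hW : IsStandardBrownian W P) (t : ℝ≥0) (i : Fin n) :
    MemLp (fun ω => W t ω i) 2 P :=
  ((hW.isBrownian i).hasLaw_eval t).hasGaussianLaw.memLp_two

lemma IsStandardBrownian.integral_mul (hW : IsStandardBrownian W P) (s t : ℝ≥0) (i j : Fin n) :
    ∫ ω, W s ω i * W t ω j ∂P = if i = j then (min s t : ℝ) else 0 := by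
  have := ((hW.isBrownian i).hasLaw_eval 0).isProbabilityMeasure
  have h0 : ∀ t i, ∫ ω, W t ω i ∂P = 0 := fun t i => (hW.isBrownian i).integral_eval t
  have hcov : ∫ ω, W s ω i * W t ω j ∂P = cov[fun ω => W s ω i, fun ω => W t ω j; P] := by
    rw [covariance_eq_sub (hW.memLp_two s i) (hW.memLp_two t j), h0, h0]
    simp
  rw [hcov]
  split_ifs with hij
  · subst hij
    simpa using (hW.isBrownian i).covariance_fun_eval s t
  · have := (hW.indep.indepFun hij).comp (measurable_pi_apply s) (measurable_pi_apply t)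
    exact this.covariance_eq_zero (hW.memLp_two s i) (hW.memLp_two t j)

lemma IsStandardBrownian.memLp_two_dotProduct (hW : IsStandardBrownian W P) (c : Fin n → ℝ)
    (t : ℝ≥0) : MemLp (fun ω => dotProduct c (W t ω)) 2 P :=
  memLp_finsetSum _ fun i _ => (hW.memLp_two t i).const_mul (c i)

lemma IsStandardBrownian.integral_dotProduct_mul (hW : IsStandardBrownian W P) (c : Fin n → ℝ)
    (s t : ℝ≥0) : ∫ ω, dotProduct c (W s ω) * dotProduct c (W t ω) ∂P
      = dotProduct c c * min (s : ℝ) t := by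
  have hint : ∀ i j, Integrable (fun ω => c i * c j * (W s ω i * W t ω j)) P := fun i j =>
    ((hW.memLp_two s i).integrable_mul (hW.memLp_two t j)).const_mul _
  have : ∀ ω, dotProduct c (W s ω) * dotProduct c (W t ω)
      = ∑ i, ∑ j, c i * c j * (W s ω i * W t ω j) := fun ω => by
    simp only [dotProduct, Finset.sum_mul_sum]
    exact Finset.sum_congr rfl fun i _ => Finset.sum_congr rfl fun j _ => by ring
  simp_rw [this]
  rw [integral_finsetSum _ fun i _ => integrable_finsetSum _ fun j _ => hint i j]
  simp_rw [integral_finsetSum _ fun j _ => hint _ j, integral_const_mul, hW.integral_mul]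
  simp [dotProduct, Finset.sum_mul]

lemma IsStandardBrownian.continuous_path (hW : IsStandardBrownian W P) :
    ∀ᵐ ω ∂P, Continuous (fun t => W t ω) := by
  filter_upwards [ae_all_iff.2 fun i => (hW.isBrownian i).cont] with ω hω
  exact continuous_pi hω

end Brownian

/-! ### Decoupling the Langevin equation -/

section Langevin

variable {n : ℕ} {Ω : Type*} [MeasurableSpace Ω] {P : Measure Ω}
  {W θ : ℝ≥0 → Ω → Fin n → ℝ} {H G S : Matrix (Fin n) (Fin n) ℝ}

/-- In a coordinate `r` with `r G H = l r` the Langevin equation is a scalar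
Ornstein–Uhlenbeck equation. -/
lemma IsPreconditionedLangevin.scalar_equation (hθ : IsPreconditionedLangevin G H S W θ P)
    {r : Fin n → ℝ} {l : ℝ} (hr : Matrix.vecMul r (G * H) = l • r) :
    ∀ᵐ ω ∂P, ∀ t : ℝ≥0, dotProduct r (θ t ω)
      = -(l * ∫ s in (0 : ℝ)..(t : ℝ), dotProduct r (θ s.toNNReal ω))
        + dotProduct (Matrix.vecMul r (G * CFC.sqrt S)) (W t ω) := by
  filter_upwards [hθ.continuous_path, hθ.equation] with ω h1 h2 t
  have hc : Continuous fun s : ℝ => (G * H).mulVec (θ s.toNNReal ω) :=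
    Continuous.matrix_mulVec continuous_const (h1.comp continuous_real_toNNReal)
  let φ : (Fin n → ℝ) →L[ℝ] ℝ :=
    LinearMap.toContinuousLinearMap (dotProductBilin ℝ ℝ r)
  have hφ : ∀ x, φ x = dotProduct r x := fun x => rfl
  have hint : dotProduct r (∫ s in (0 : ℝ)..(t : ℝ), (G * H).mulVec (θ s.toNNReal ω))
      = ∫ s in (0 : ℝ)..(t : ℝ), l * dotProduct r (θ s.toNNReal ω) := by
    rw [← hφ, ← φ.intervalIntegral_comp_comm (hc.intervalIntegrable _ _)]
    refine intervalIntegral.integral_congr fun s _ => ?_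
    simp only [hφ, Matrix.dotProduct_mulVec, hr, smul_dotProduct, smul_eq_mul]
  conv_lhs => rw [h2 t]
  rw [dotProduct_add, dotProduct_neg, hint, intervalIntegral.integral_const_mul,
    Matrix.dotProduct_mulVec]

/-- Writing the noise variance as `l ^ 2 * m` cancels the denominator `2 * l`, so one formula also
covers `l = 0`, where both drift and noise vanish. -/
lemma IsPreconditionedLangevin.second_moment_dotProduct [IsProbabilityMeasure P]
    (hθ : IsPreconditionedLangevin G H S W θ P) (hW : IsStandardBrownian W P)
    {r : Fin n → ℝ} {l m : ℝ} (hr : Matrix.vecMul r (G * H) = l • r)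
    (hm : dotProduct (Matrix.vecMul r (G * CFC.sqrt S)) (Matrix.vecMul r (G * CFC.sqrt S))
      = l ^ 2 * m) (t : ℝ≥0) :
    Integrable (fun ω => dotProduct r (θ t ω) ^ 2) P ∧
    ∫ ω, dotProduct r (θ t ω) ^ 2 ∂P = l * m * (1 - Real.exp (-(l * t)) ^ 2) / 2 := by
  have heq := hθ.scalar_equation hr
  rcases eq_or_ne l 0 with rfl | hl
  · have hc : Matrix.vecMul r (G * CFC.sqrt S) = 0 := by
      rwa [zero_pow two_ne_zero, zero_mul, dotProduct_self_eq_zero] at hm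
    have h0 : ∀ᵐ ω ∂P, (0 : ℝ) = dotProduct r (θ t ω) ^ 2 := by
      filter_upwards [heq] with ω hω
      rw [hω t, hc]
      simp
    refine ⟨(integrable_zero Ω ℝ P).congr h0, ?_⟩
    rw [← integral_congr_ae h0]
    simp
  · have h := second_moment_ornsteinUhlenbeck hl
      (hW.memLp_two_dotProduct (Matrix.vecMul r (G * CFC.sqrt S)))
      (hW.continuous_path.mono fun ω hω => by
        exact Continuous.dotProduct continuous_const hω)
      (hW.integral_dotProduct_mul _)
      (hθ.continuous_path.mono fun ω hω => by
        exact Continuous.dotProduct continuous_const hω) heq t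
    refine ⟨h.1, h.2.trans ?_⟩
    rw [hm]
    field_simp

open Matrix in
/-- The asymptotic expected loss of the preconditioned Langevin equation. -/
theorem IsPreconditionedLangevin.tendsto_expectedLoss [IsProbabilityMeasure P]
    (hθ : IsPreconditionedLangevin G H S W θ P) (hW : IsStandardBrownian W P)
    (hH : H.PosDef) (hG : G.PosSemidef) (hS : S.PosSemidef) :
    (∀ t, Integrable (fun ω => quadLoss H (θ t ω)) P) ∧
      Tendsto (expectedLoss H θ P) atTop (𝓝 ((1 / 4 : ℝ) * (S * G).trace)) := by
  obtain ⟨R, l, hRu, hRR, hRG, hl⟩ := exists_simultaneous_diagonalization hH hG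
  have hRi : R * R⁻¹ = 1 := mul_nonsing_inv R hRu
  have hiR : R⁻¹ * R = 1 := nonsing_inv_mul R hRu
  have hRGH : R * (G * H) = diagonal l * R := by
    rw [← hRR, ← hRG]
    simp only [Matrix.mul_assoc]
  have hRGi : R * G = diagonal l * R⁻¹ᵀ := by
    rw [← hRG, Matrix.mul_assoc (R * G), ← transpose_mul, hiR, transpose_one, Matrix.mul_one]
  -- Noise covariance in the dual coordinates: `R G = diagonal l * R⁻ᵀ` turns the covariance of the
  -- noise in `R θ` into `diagonal l * M * diagonal l`.
  set M := R⁻¹ᵀ * S * R⁻¹ with hM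
  have hGt : Gᵀ = G := by
    have := hG.isHermitian.eq
    rwa [conjTranspose_eq_transpose_of_trivial] at this
  have hSt : (CFC.sqrt S)ᵀ = CFC.sqrt S := by
    have := (CFC.sqrt_nonneg S).posSemidef.isHermitian.eq
    rwa [conjTranspose_eq_transpose_of_trivial] at this
  have hSS : CFC.sqrt S * CFC.sqrt S = S := CFC.sqrt_mul_sqrt_self S hS.nonneg
  have hCC : (R * (G * CFC.sqrt S)) * (R * (G * CFC.sqrt S))ᵀ = diagonal l * M * diagonal l := by
    have h1 : (R * (G * CFC.sqrt S)) * (R * (G * CFC.sqrt S))ᵀ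
        = R * G * (CFC.sqrt S * CFC.sqrt S) * (R * G)ᵀ := by
      rw [← Matrix.mul_assoc R, transpose_mul (R * G), hSt]
      simp only [Matrix.mul_assoc]
    rw [h1, hSS, hRGi, transpose_mul, transpose_transpose, diagonal_transpose, hM]
    simp only [Matrix.mul_assoc]
  have htr : ∑ i, l i * M i i = (S * G).trace := by
    have h1 : (diagonal l * M).trace = ∑ i, l i * M i i := by
      simp [Matrix.trace, diagonal_mul]
    rw [← h1, hM, ← Matrix.mul_assoc, ← Matrix.mul_assoc, ← hRGi, Matrix.trace_mul_comm,
      ← Matrix.mul_assoc, ← Matrix.mul_assoc, hiR, Matrix.one_mul, Matrix.trace_mul_comm]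
  have hmom : ∀ t i, Integrable (fun ω => dotProduct (R i) (θ t ω) ^ 2) P ∧
      ∫ ω, dotProduct (R i) (θ t ω) ^ 2 ∂P
        = l i * M i i * (1 - Real.exp (-(l i * t)) ^ 2) / 2 := by
    intro t i
    refine hθ.second_moment_dotProduct hW ?_ ?_ t
    · ext j
      have := congrFun (congrFun hRGH i) j
      rw [diagonal_mul] at this
      exact this
    · have := congrFun (congrFun hCC i) i
      rw [mul_diagonal, diagonal_mul] at this
      refine Eq.trans ?_ (this.trans (by ring))
      rfl
  have hloss : ∀ x, quadLoss H x = ∑ i, (1 / 2 : ℝ) * dotProduct (R i) x ^ 2 := by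
    intro x
    rw [quadLoss, ← hRR, ← mulVec_mulVec, dotProduct_mulVec, vecMul_transpose, dotProduct,
      Finset.mul_sum]
    exact Finset.sum_congr rfl fun i _ => by rw [sq]; rfl
  have hint : ∀ t i, Integrable (fun ω => (1 / 2 : ℝ) * dotProduct (R i) (θ t ω) ^ 2) P :=
    fun t i => (hmom t i).1.const_mul _
  refine ⟨fun t => ?_, ?_⟩
  · simp_rw [hloss]
    exact integrable_finsetSum _ fun i _ => hint t i
  · have hE : expectedLoss H θ P = fun t : ℝ≥0 =>
        ∑ i, (1 / 2 : ℝ) * (l i * M i i * (1 - Real.exp (-(l i * t)) ^ 2) / 2) := by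
      funext t
      simp_rw [expectedLoss, hloss]
      rw [integral_finsetSum _ fun i _ => hint t i]
      simp_rw [integral_const_mul, (hmom t _).2]
    rw [hE, ← htr, Finset.mul_sum]
    refine tendsto_finsetSum _ fun i _ => ?_
    rcases (hl i).eq_or_lt with h0 | hpos
    · simp [← h0]
    · have hexp : Tendsto (fun t : ℝ≥0 => Real.exp (-(l i * t))) atTop (𝓝 0) :=
        Real.tendsto_exp_neg_atTop_nhds_zero.comp
          (NNReal.tendsto_coe_atTop.2 tendsto_id |>.const_mul_atTop hpos)
      have := ((((hexp.pow 2).const_sub 1).const_mul (l i * M i i)).div_const 2).const_mul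
        (1 / 2 : ℝ)
      refine this.congr' EventuallyEq.rfl |>.trans (le_of_eq ?_)
      congr 1
      ring

end Langevin

end LangevinLoss

/-! ### Main theorem -/

theorem corollary8 {n : ℕ} (H S : Matrix (Fin n) (Fin n) ℝ) (hH : H.PosDef)
    (𝒢 : Set (Matrix (Fin n) (Fin n) ℝ))
    (h𝒢 : 𝒢 = {G | G.PosDef} ∨ 𝒢 = {G | G.PosSemidef})
    (hS : S ∈ 𝒢) (hS0 : S ≠ 0)
    {Ω : Matrix (Fin n) (Fin n) ℝ → Type*} [∀ G, MeasurableSpace (Ω G)]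
    (P : ∀ G, Measure (Ω G)) [∀ G, IsProbabilityMeasure (P G)]
    (W θ : ∀ G, ℝ≥0 → Ω G → Fin n → ℝ)
    (hW : ∀ G ∈ 𝒢, LangevinLoss.frobeniusNorm G = 1 →
      LangevinLoss.IsStandardBrownian (W G) (P G))
    (hθ : ∀ G ∈ 𝒢, LangevinLoss.frobeniusNorm G = 1 →
      LangevinLoss.IsPreconditionedLangevin G H S (W G) (θ G) (P G)) :
    (∀ G ∈ 𝒢, LangevinLoss.frobeniusNorm G = 1 →
      (∀ t, Integrable (fun ω => LangevinLoss.quadLoss H (θ G t ω)) (P G)) ∧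
      Tendsto (LangevinLoss.expectedLoss H (θ G) (P G)) atTop
        (𝓝 (LangevinLoss.asymptoticLoss H (θ G) (P G))) ∧
      LangevinLoss.asymptoticLoss H (θ G) (P G) = (1 / 4 : ℝ) * (S * G).trace) ∧
    LangevinLoss.argmaxSet {G | G ∈ 𝒢 ∧ LangevinLoss.frobeniusNorm G = 1}
        (fun G => LangevinLoss.asymptoticLoss H (θ G) (P G)) =
      {(LangevinLoss.frobeniusNorm S)⁻¹ • S} := by
  have hpsd : ∀ G ∈ 𝒢, G.PosSemidef := by
    rcases h𝒢 with rfl | rfl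
    · exact fun G hG => Matrix.PosDef.posSemidef hG
    · exact fun G hG => hG
  -- Both choices of `𝒢` are stable under positive scaling, so the normalized `S` is admissible.
  have hsmul : ∀ c : ℝ, 0 < c → c • S ∈ 𝒢 := by
    rcases h𝒢 with rfl | rfl
    · exact fun c hc => Matrix.PosDef.smul hS hc
    · exact fun c hc => Matrix.PosSemidef.smul hS hc.le
  have hmain : ∀ G ∈ 𝒢, LangevinLoss.frobeniusNorm G = 1 →
      (∀ t, Integrable (fun ω => LangevinLoss.quadLoss H (θ G t ω)) (P G)) ∧
      Tendsto (LangevinLoss.expectedLoss H (θ G) (P G)) atTop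
        (𝓝 (LangevinLoss.asymptoticLoss H (θ G) (P G))) ∧
      LangevinLoss.asymptoticLoss H (θ G) (P G) = (1 / 4 : ℝ) * (S * G).trace := by
    intro G hG hG1
    obtain ⟨h1, h2⟩ :=
      (hθ G hG hG1).tendsto_expectedLoss (hW G hG hG1) hH (hpsd G hG) (hpsd S hS)
    have h3 : LangevinLoss.asymptoticLoss H (θ G) (P G) = (1 / 4 : ℝ) * (S * G).trace :=
      h2.limUnder_eq
    exact ⟨h1, h3 ▸ h2, h3⟩
  have hpos : 0 < LangevinLoss.frobeniusNorm S :=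
    (LangevinLoss.frobeniusNorm_nonneg S).lt_of_ne' (mt LangevinLoss.frobeniusNorm_eq_zero.1 hS0)
  have hsymm : S.IsSymm := by
    have := (hpsd S hS).isHermitian.eq
    rwa [Matrix.conjTranspose_eq_transpose_of_trivial] at this
  refine ⟨hmain, LangevinLoss.argmaxSet_trace_mul hsymm hS0 (fun G hG => hG.2) ?_
    (c := 1 / 4) (by norm_num) fun G hG => (hmain G hG.1 hG.2).2.2⟩
  refine ⟨hsmul _ (inv_pos.2 hpos), ?_⟩
  rw [LangevinLoss.frobeniusNorm_smul (inv_pos.2 hpos).le, inv_mul_cancel₀ hpos.ne']
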